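/- **Proposition ($L^2$ norms of the $X_m$ Jacobi polynomials).** For real $a,b$ and an integer $n\ge 0$ let $$P_n^{(a,b)}(x)=\sum_{s=0}^{n}\frac{(n+a+b+1)_s\,(a+s+1)_{n-s}}{s!\,(n-s)!}\Big(\frac{x-1}{2}\Big)^s,\qquad (t)_s=t(t+1)\cdots(t+s-1),$$ be the Jacobi polynomial (with arbitrary real parameters), and put $$N^{a,b}_n=\frac{2^{a+b+1}\,\Gamma(a+1+n)\,\Gamma(b+1+n)}{n!\,(a+b+2n+1)\,\Gamma(a+b+n+1)},$$ where for $n=0$ the product $(a+b+1)\Gamma(a+b+1)$ is read as $\Gamma(a+b+2)$. Let $m\ge 1$ be an integer and set $\xi_{a,b,m}=P_m^{(-a,b)}$ and $$A_{a,b,m}(y)=(1-x)\,\xi_{a,b,m}\,y'+(m-a)\,\xi_{a+1,b+1,m}\,y .$$ For $\alpha,\beta>-1$ define the $X_m$ Jacobi polynomials and their weight by $$\hat P^{(\alpha,\beta,m)}_{n}=\frac{(-1)^{m+1}}{\alpha+1+j}\,A_{\alpha+1,\beta-1,m}\big(P_{j}^{(\alpha+1,\beta-1)}\big),\quad j=n-m\ge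 0,\qquad \hat W_{\alpha,\beta,m}(x)=\frac{(1-x)^\alpha(1+x)^\beta}{\xi_{\alpha+1,\beta-1,m}(x)^2},\quad x\in(-1,1).$$ Suppose that $\alpha,\beta>-1$ satisfy $\beta\ne 0$, $\;\alpha\notin\{0,1,\dots,m-1\}$, $\;\alpha-\beta-m+1\notin\{0,1,\dots,m-1\}$, $\;\alpha>m-2$ and $\operatorname{sgn}(\alpha-m+1)=\operatorname{sgn}(\beta)$. Then for every integer $k\ge 0$ the following integral converges absolutely and $$\int_{-1}^{1}\big[\hat P^{(\alpha,\beta,m)}_{m+k}(x)\big]^2\,\hat W_{\alpha,\beta,m}(x)\,dx=\frac{(1+\alpha+k-m)(\beta+m+k)}{(\alpha+1+k)^2}\,N^{\alpha+1,\beta-1}_{k}.$$ -/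

import Mathlib

open Polynomial MeasureTheory

noncomputable section

/-- The Jacobi polynomial `P_n^{(a,b)}`, for arbitrary real parameters `a`, `b`:
`∑_{s ≤ n} (n+a+b+1)_s (a+s+1)_{n-s} / (s! (n-s)!) ((x-1)/2)^s`,
where `(t)_s = t (t+1) ⋯ (t+s-1)`. -/
def jacobiPoly (a b : ℝ) (n : ℕ) : ℝ[X] :=
  ∑ s ∈ Finset.range (n + 1),
    C ((ascPochhammer ℝ s).eval ((n : ℝ) + a + b + 1) *
        (ascPochhammer ℝ (n - s)).eval (a + (s : ℝ) + 1) /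
        ((s.factorial : ℝ) * ((n - s).factorial : ℝ))) *
      (C (1 / 2) * (X - 1)) ^ s

/-- `ξ_{a,b,m} = P_m^{(-a,b)}`. -/
def xiPoly (a b : ℝ) (m : ℕ) : ℝ[X] :=
  jacobiPoly (-a) b m

/-- The first-order operator
`A_{a,b,m}(y) = (1-x) ξ_{a,b,m} y' + (m-a) ξ_{a+1,b+1,m} y`. -/
def jacobiA (a b : ℝ) (m : ℕ) (y : ℝ[X]) : ℝ[X] :=
  (1 - X) * xiPoly a b m * derivative y +
    C ((m : ℝ) - a) * xiPoly (a + 1) (b + 1) m * y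

/-- The exceptional Jacobi polynomial of degree index `n ≥ m`:
`(-1)^(m+1) / (α+1+j) * A_{α+1,β-1,m} P_j^{(α+1,β-1)}` with `j = n - m`.
(Only the values with `n ≥ m` are meaningful.) -/
def xmJacobi (α β : ℝ) (m n : ℕ) : ℝ[X] :=
  C ((-1) ^ (m + 1) / (α + 1 + ((n - m : ℕ) : ℝ))) *
    jacobiA (α + 1) (β - 1) m (jacobiPoly (α + 1) (β - 1) (n - m))

/-- The weight `(1-x)^α (1+x)^β / ξ_{α+1,β-1,m}(x)^2`, considered on `(-1,1)`. -/
def xmWeight (α β : ℝ) (m : ℕ) (x : ℝ) : ℝ :=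
  (1 - x) ^ α * (1 + x) ^ β / ((xiPoly (α + 1) (β - 1) m).eval x) ^ 2

/-- The classical constant
`N_n^{a,b} = 2^(a+b+1) Γ(a+1+n) Γ(b+1+n) / (n! (a+b+2n+1) Γ(a+b+n+1))`.
For `n = 0` the product `(a+b+1) Γ(a+b+1)` is `Γ(a+b+2)`, which also gives it its
(limiting) value when `a + b + 1 = 0`. -/
def jacobiNorm (a b : ℝ) (n : ℕ) : ℝ :=
  (2 : ℝ) ^ (a + b + 1) * Real.Gamma (a + 1 + n) * Real.Gamma (b + 1 + n) /
    ((n.factorial : ℝ) *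
      (if n = 0 then Real.Gamma (a + b + 2)
        else (a + b + 2 * n + 1) * Real.Gamma (a + b + n + 1)))

end

/-! Put `a = α + 1`, `b = β - 1`, `y = P_k^{(a,b)}`, `ξ = P_m^{(-a,b)}`. The Jacobi equations of `y`
and `ξ` make a second first-order operator send `A y` back to a multiple `-L ξ y`, where `L =
(a+k-m)(b+1+m+k)` (`jacobiA_adjoint`). When `b > -1`, integrating by parts would give `‖A y‖² = L
‖y‖²`, with `ξ⁻²` in the weight on the left.

For `-1 < β < 0` the integral of `y²` against `(1-x)^a (1+x)^b` may diverge at `-1`. So `c y²` times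
this weight is first written as an exact derivative plus a remainder against the integrable weight
`(1-x)^a (1+x)^(b+1)`. `integral_jacobiA_sq` does this for both signs of `β`, and the remainder is
evaluated by the beta integral (`k = 0`) or by the classical norm of `P_{k-1}^{(a+1,b+1)}` (`k ≥
1`).

Division by `ξ` is legitimate because, in a Bernstein-type expansion of `ξ`, all terms have the same
sign on `[-1,1]`; the sign hypothesis on `α - m + 1` and `β` gives this. -/

theorem ascPochhammer_eval_succ_left (n : ℕ) (x : ℝ) :
    (ascPochhammer ℝ (n + 1)).eval x = x * (ascPochhammer ℝ n).eval (x + 1) := by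
  simp [ascPochhammer_succ_left, eval_comp]

/-! ### Coefficient identities: differential equation, derivative, contiguity. -/

/-- The Jacobi polynomial written in the variable `t = (x - 1) / 2`. -/
noncomputable def jacobiCore (a b : ℝ) (n : ℕ) : ℝ[X] :=
  ∑ s ∈ Finset.range (n + 1),
    C ((ascPochhammer ℝ s).eval ((n : ℝ) + a + b + 1) *
        (ascPochhammer ℝ (n - s)).eval (a + (s : ℝ) + 1) /
        ((s.factorial : ℝ) * ((n - s).factorial : ℝ))) * X ^ s

theorem jacobiPoly_eq_comp (a b : ℝ) (n : ℕ) :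
    jacobiPoly a b n = (jacobiCore a b n).comp (C (1 / 2) * (X - 1)) := by
  rw [jacobiCore, ← coe_compRingHom_apply, map_sum]
  simp [jacobiPoly]

theorem derivative_comp_half_sub_one (p : ℝ[X]) :
    derivative (p.comp (C (1 / 2) * (X - 1))) =
      C (1 / 2) * (derivative p).comp (C (1 / 2) * (X - 1)) := by
  rw [derivative_comp]
  congr 1
  rw [derivative_mul, derivative_C]
  simp

theorem jacobiCore_coeff (a b : ℝ) (n s : ℕ) :
    (jacobiCore a b n).coeff s = if s ≤ n then
      (ascPochhammer ℝ s).eval ((n : ℝ) + a + b + 1) *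
        (ascPochhammer ℝ (n - s)).eval (a + (s : ℝ) + 1) /
        ((s.factorial : ℝ) * ((n - s).factorial : ℝ)) else 0 := by
  simp only [jacobiCore, finsetSum_coeff, coeff_C_mul, coeff_X_pow, mul_ite, mul_one, mul_zero,
    Finset.sum_ite_eq, Finset.mem_range, Nat.lt_succ_iff]

/-- The hypergeometric ratio of consecutive coefficients, cleared of denominators since `a + s + 1`
may vanish; it is the Jacobi equation read coefficientwise. -/
theorem jacobiCore_coeff_succ (a b : ℝ) (n s : ℕ) :
    ((s : ℝ) + 1) * (a + s + 1) * (jacobiCore a b n).coeff (s + 1) =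
      ((n : ℝ) + a + b + 1 + s) * ((n : ℝ) - s) * (jacobiCore a b n).coeff s := by
  rw [jacobiCore_coeff, jacobiCore_coeff]
  rcases lt_trichotomy s n with h | rfl | h
  · obtain ⟨r, rfl⟩ := Nat.exists_eq_add_of_lt h
    have e1 : s + r + 1 - (s + 1) = r := by omega
    have e2 : s + r + 1 - s = r + 1 := by omega
    rw [if_pos (by omega), if_pos (by omega), e1, e2, ascPochhammer_succ_eval,
      ascPochhammer_eval_succ_left, Nat.factorial_succ, Nat.factorial_succ]
    push_cast
    rw [show a + (s : ℝ) + 1 + 1 = a + (s + 1) + 1 by ring]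
    have := s.factorial_ne_zero
    have := r.factorial_ne_zero
    field_simp
    ring
  · simp
  · rw [if_neg (by omega), if_neg (by omega)]; simp

theorem jacobiCore_ode (a b : ℝ) (n : ℕ) :
    X * (1 + X) * derivative (derivative (jacobiCore a b n)) +
        (C (a + 1) + C (a + b + 2) * X) * derivative (jacobiCore a b n) =
      C ((n : ℝ) * (n + a + b + 1)) * jacobiCore a b n := by
  ext s
  have h := jacobiCore_coeff_succ a b n s
  rw [mul_add, mul_one, add_mul, add_mul, mul_assoc X X, mul_assoc (C _) X]
  rcases s with _ | _ | s
  · simp [coeff_derivative] at h ⊢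
    linarith
  · simp only [coeff_add, coeff_X_mul, coeff_C_mul, coeff_derivative, coeff_X_mul_zero]
    push_cast at h ⊢
    linarith
  · simp only [coeff_add, coeff_X_mul, coeff_C_mul, coeff_derivative]
    push_cast at h ⊢
    linear_combination h

theorem jacobiPoly_ode (a b : ℝ) (n : ℕ) :
    (1 - X ^ 2) * derivative (derivative (jacobiPoly a b n)) =
      (C (a - b) + C (a + b + 2) * X) * derivative (jacobiPoly a b n) -
      C ((n : ℝ) * (n + a + b + 1)) * jacobiPoly a b n := by
  have h := congrArg (fun p => p.comp (C (1 / 2) * (X - 1))) (jacobiCore_ode a b n)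
  have hC : (C (1 / 2 : ℝ) : ℝ[X]) * 2 = 1 := by
    rw [show (2 : ℝ[X]) = C 2 from rfl, ← C_mul]; norm_num
  simp only [jacobiPoly_eq_comp, derivative_comp_half_sub_one, derivative_C_mul] at h ⊢
  simp only [mul_comp, add_comp, X_comp, one_comp, C_comp, C_add, C_sub, C_mul, C_1] at h ⊢
  have h2 : (C (2 : ℝ) : ℝ[X]) = 2 := rfl
  rw [h2] at h ⊢
  linear_combination -h - (C (1 / 2) * (X - 1) *
    (derivative (derivative (jacobiCore a b n))).comp (C (1 / 2) * (X - 1)) +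
    (C a + 1) * (derivative (jacobiCore a b n)).comp (C (1 / 2) * (X - 1))) * hC

theorem jacobiPoly_derivative (a b : ℝ) (n : ℕ) :
    derivative (jacobiPoly a b (n + 1)) =
      C (((n : ℝ) + a + b + 2) / 2) * jacobiPoly (a + 1) (b + 1) n := by
  have h : derivative (jacobiCore a b (n + 1)) =
      C ((n : ℝ) + a + b + 2) * jacobiCore (a + 1) (b + 1) n := by
    ext s
    rw [coeff_derivative, coeff_C_mul, jacobiCore_coeff, jacobiCore_coeff]
    by_cases hs : s ≤ n
    · rw [if_pos (by omega), if_pos hs, Nat.add_sub_add_right, ascPochhammer_eval_succ_left,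
        Nat.factorial_succ]
      push_cast
      rw [show (n : ℝ) + (a + 1) + (b + 1) + 1 = n + 1 + a + b + 1 + 1 by ring,
        show a + 1 + (s : ℝ) + 1 = a + (s + 1) + 1 by ring]
      have := s.factorial_ne_zero
      have := (n - s).factorial_ne_zero
      field_simp
      ring
    · rw [if_neg (by omega), if_neg hs]; simp
  rw [jacobiPoly_eq_comp, jacobiPoly_eq_comp, derivative_comp_half_sub_one, h, mul_comp, C_comp,
    ← mul_assoc, ← C_mul]
  congr 2
  ring

theorem xiPoly_contiguous (a b : ℝ) (m : ℕ) :
    C ((m : ℝ) - a) * xiPoly (a + 1) (b + 1) m =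
      (X - 1) * derivative (xiPoly a b m) - C a * xiPoly a b m := by
  have h : C ((m : ℝ) - a) * jacobiCore (-(a + 1)) (b + 1) m =
      X * derivative (jacobiCore (-a) b m) - C a * jacobiCore (-a) b m := by
    ext s
    have hX : (X * derivative (jacobiCore (-a) b m)).coeff s =
        s * (jacobiCore (-a) b m).coeff s := by
      rcases s with _ | s
      · simp
      · rw [coeff_X_mul, coeff_derivative]; push_cast; ring
    rw [coeff_sub, hX, coeff_C_mul, coeff_C_mul, ← sub_mul, jacobiCore_coeff, jacobiCore_coeff]
    split_ifs with hs
    -- Both sides equal `(s - a)_{m-s+1}`, split at its last or its first factor.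
    · have key : ((m : ℝ) - a) * (ascPochhammer ℝ (m - s)).eval (-(a + 1) + (s : ℝ) + 1) =
          (s - a) * (ascPochhammer ℝ (m - s)).eval (-a + (s : ℝ) + 1) := by
        have h1 := ascPochhammer_eval_succ_left (m - s) ((s : ℝ) - a)
        rw [ascPochhammer_succ_eval, Nat.cast_sub hs] at h1
        rw [show -(a + 1) + (s : ℝ) + 1 = s - a by ring, show -a + (s : ℝ) + 1 = s - a + 1 by ring,
          ← h1]
        ring
      rw [show (m : ℝ) + -(a + 1) + (b + 1) + 1 = m + -a + b + 1 by ring]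
      linear_combination ((ascPochhammer ℝ s).eval ((m : ℝ) + -a + b + 1) /
        ((s.factorial : ℝ) * ((m - s).factorial : ℝ))) * key
    · simp
  have h' := congrArg (fun p => p.comp (C (1 / 2) * (X - 1))) h
  simp only [xiPoly, jacobiPoly_eq_comp, derivative_comp_half_sub_one, mul_comp, sub_comp, X_comp, C_comp] at h' ⊢
  rw [h']
  ring

/-! ### Bernstein-type expansion and absence of zeros on `[-1,1]`. -/

theorem factorial_mul_choose (x : ℝ) (n : ℕ) :
    (n.factorial : ℝ) * Ring.choose x n = ∏ i ∈ Finset.range n, (x - i) := by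
  rw [← nsmul_eq_mul, ← Ring.descPochhammer_eq_factorial_smul_choose,
    ← descPochhammer_eval_eq_prod_range, ← descPochhammer_map (Int.castRingHom ℝ),
    eval_map, ← eval₂_smulOneHom_eq_smeval]
  congr 1
  exact RingHom.ext_int _ _

theorem ascPochhammer_eval_eq_choose (x y : ℝ) (n : ℕ) (h : y = x + n - 1) :
    (ascPochhammer ℝ n).eval x = n.factorial * Ring.choose y n := by
  rw [factorial_mul_choose, ← descPochhammer_eval_eq_prod_range,
    descPochhammer_eval_eq_ascPochhammer, h]
  congr 1
  ring

/-- Expand `(t + 1)^(m-s)` by the binomial theorem; the coefficient of `t^r` then collapses by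
Vandermonde's identity for real upper arguments. -/
theorem jacobiPoly_eval_bernstein (a b x : ℝ) (m : ℕ) :
    (jacobiPoly a b m).eval x = ∑ s ∈ Finset.range (m + 1),
      Ring.choose (m + a) (m - s) * Ring.choose (m + b) s *
        (((x - 1) / 2) ^ s * ((x + 1) / 2) ^ (m - s)) := by
  set t := (x - 1) / 2 with ht
  have hx : (x + 1) / 2 = t + 1 := by rw [ht]; ring
  have h1 : ∀ s ∈ Finset.range (m + 1),
      Ring.choose (m + a) (m - s) * Ring.choose (m + b) s * (t ^ s * (t + 1) ^ (m - s)) =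
      ∑ r ∈ Finset.range (m + 1 - s), Ring.choose (m + a) (m - s) * Ring.choose (m + b) s *
        (((m - s).choose r : ℕ) : ℝ) * t ^ (s + r) := by
    intro s hs
    rw [add_pow, Nat.sub_add_comm (by simpa [Nat.lt_succ_iff] using hs), Finset.mul_sum,
      Finset.mul_sum]
    refine Finset.sum_congr rfl fun r _ => ?_
    rw [pow_add]; simp; ring
  rw [hx, Finset.sum_congr rfl h1, ← Finset.sum_range_diag_flip (m + 1) (fun s r =>
    Ring.choose ((m : ℝ) + a) (m - s) * Ring.choose ((m : ℝ) + b) s *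
        (((m - s).choose r : ℕ) : ℝ) * t ^ (s + r))]
  rw [jacobiPoly_eq_comp, jacobiCore, eval_comp, eval_finsetSum]
  refine Finset.sum_congr rfl fun r hr => ?_
  have hrm : r ≤ m := by simpa [Nat.lt_succ_iff] using hr
  have h2 : ∀ k ∈ Finset.range (r + 1),
      Ring.choose ((m : ℝ) + a) (m - k) * Ring.choose ((m : ℝ) + b) k *
        (((m - k).choose (r - k) : ℕ) : ℝ) * t ^ (k + (r - k)) =
      Ring.choose ((m : ℝ) + a) (m - r) * t ^ r *
        (Ring.choose ((m : ℝ) + b) k * Ring.choose (a + r) (r - k)) := by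
    intro k hk
    have hkr : k ≤ r := by simpa [Nat.lt_succ_iff] using hk
    have h3 := Ring.choose_smul_choose ((m : ℝ) + a) (n := m - k) (k := m - r) (by omega)
    rw [show m - k - (m - r) = r - k by omega, Nat.cast_sub hrm,
      show (m : ℝ) + a - (m - r) = a + r by ring, nsmul_eq_mul,
      Nat.choose_symm_of_eq_add (show m - k = (m - r) + (r - k) by omega)] at h3
    rw [show k + (r - k) = r by omega]
    linear_combination (Ring.choose ((m : ℝ) + b) k * t ^ r) * h3
  rw [Finset.sum_congr rfl h2, ← Finset.mul_sum, ← Finset.Nat.sum_antidiagonal_eq_sum_range_succ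
    (fun i j => Ring.choose ((m : ℝ) + b) i * Ring.choose (a + r) j),
    ← Ring.add_choose_eq r (Commute.all _ _),
    ascPochhammer_eval_eq_choose _ ((m : ℝ) + b + (a + r)) r (by ring),
    ascPochhammer_eval_eq_choose _ ((m : ℝ) + a) (m - r) (by rw [Nat.cast_sub hrm]; ring)]
  have := r.factorial_ne_zero
  have := (m - r).factorial_ne_zero
  have e : eval x (C (1 / 2) * (X - 1)) = t := by simp [ht]; ring
  rw [e]
  simp
  field_simp

theorem succ_mul_choose_succ (x : ℝ) (n : ℕ) :
    ((n : ℝ) + 1) * Ring.choose x (n + 1) = Ring.choose x n * (x - n) := by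
  have h := factorial_mul_choose x (n + 1)
  rw [Finset.prod_range_succ, ← factorial_mul_choose, Nat.factorial_succ] at h
  push_cast at h
  have := n.factorial_ne_zero
  refine mul_left_cancel₀ (Nat.cast_ne_zero.2 this : (n.factorial : ℝ) ≠ 0) ?_
  linear_combination h

theorem choose_pos_of_lt {x : ℝ} {n : ℕ} (h : (n : ℝ) - 1 < x) : 0 < Ring.choose x n := by
  induction n with
  | zero => simp
  | succ n ih =>
    push_cast at h
    have h1 := mul_pos (ih (by linarith)) (by linarith : 0 < x - n)
    rw [← succ_mul_choose_succ] at h1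
    exact pos_of_mul_pos_right h1 (by positivity)

theorem neg_one_pow_mul_choose_pos_of_neg {x : ℝ} (h : x < 0) (n : ℕ) :
    0 < (-1) ^ n * Ring.choose x n := by
  induction n with
  | zero => simp
  | succ n ih =>
    have h1 := mul_pos ih (by linarith [n.cast_nonneg (α := ℝ)] : 0 < n - x)
    have h2 : (-1) ^ n * Ring.choose x n * (n - x) =
        ((n : ℝ) + 1) * ((-1) ^ (n + 1) * Ring.choose x (n + 1)) := by
      linear_combination (-(-1) ^ (n + 1)) * succ_mul_choose_succ x n
    rw [h2] at h1
    exact pos_of_mul_pos_right h1 (by positivity)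

theorem neg_one_pow_mul_choose_succ_pos {x : ℝ} (h0 : 0 < x) (h1 : x < 1) (n : ℕ) :
    0 < (-1) ^ n * Ring.choose x (n + 1) := by
  induction n with
  | zero => simpa using h0
  | succ n ih =>
    have h1 := mul_pos ih (by linarith [n.cast_nonneg (α := ℝ)] : 0 < (n : ℝ) + 1 - x)
    have h2 : (-1) ^ n * Ring.choose x (n + 1) * ((n : ℝ) + 1 - x) =
        ((n : ℝ) + 2) * ((-1) ^ (n + 1) * Ring.choose x (n + 1 + 1)) := by
      have h3 := succ_mul_choose_succ x (n + 1)
      push_cast at h3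
      linear_combination (-(-1) ^ (n + 1)) * h3
    rw [h2] at h1
    exact pos_of_mul_pos_right h1 (by positivity)

/-- On `[-1,1]` the factor `((x-1)/2)^s` contributes the sign `(-1)^s`, so the terms cannot cancel;
the strictly positive one is `s = m` at `x = -1` and `s = 0` elsewhere. -/
theorem jacobiPoly_eval_ne_zero_of_sign {a b : ℝ} {m : ℕ} (ε : ℝ)
    (h : ∀ s ≤ m, 0 < ε * (-1) ^ s * (Ring.choose (m + a) (m - s) * Ring.choose (m + b) s))
    {x : ℝ} (hx : x ∈ Set.Icc (-1 : ℝ) 1) : (jacobiPoly a b m).eval x ≠ 0 := by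
  suffices 0 < ε * (jacobiPoly a b m).eval x from right_ne_zero_of_mul this.ne'
  have h1 : 0 ≤ (1 - x) / 2 := by linarith [hx.2]
  have h2 : 0 ≤ (x + 1) / 2 := by linarith [hx.1]
  have e : ∀ s, ε * (Ring.choose (m + a) (m - s) * Ring.choose (m + b) s *
      (((x - 1) / 2) ^ s * ((x + 1) / 2) ^ (m - s))) =
      ε * (-1) ^ s * (Ring.choose (m + a) (m - s) * Ring.choose (m + b) s) *
        (((1 - x) / 2) ^ s * ((x + 1) / 2) ^ (m - s)) := by
    intro s
    rw [show (x - 1) / 2 = (-1) * ((1 - x) / 2) by ring, mul_pow]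
    ring
  rw [jacobiPoly_eval_bernstein, Finset.mul_sum]
  refine Finset.sum_pos' (fun s hs => ?_) ?_
  · rw [e]
    exact mul_nonneg (h s (by simpa [Nat.lt_succ_iff] using hs)).le (by positivity)
  · rcases hx.1.eq_or_lt with rfl | hlt
    · refine ⟨m, by simp, ?_⟩
      rw [e]
      exact mul_pos (h m le_rfl) (by norm_num)
    · refine ⟨0, by simp, ?_⟩
      rw [e]
      have : 0 < (x + 1) / 2 := by linarith
      exact mul_pos (h 0 (Nat.zero_le _)) (by positivity)

theorem jacobiPoly_eval_ne_zero_of_neg {a b : ℝ} {m : ℕ} (ha : m + a < 0) (hb : -1 < b)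
    {x : ℝ} (hx : x ∈ Set.Icc (-1 : ℝ) 1) : (jacobiPoly a b m).eval x ≠ 0 := by
  refine jacobiPoly_eval_ne_zero_of_sign ((-1) ^ m) (fun s hs => ?_) hx
  have hs' : (s : ℝ) ≤ m := by exact_mod_cast hs
  have h := mul_pos (neg_one_pow_mul_choose_pos_of_neg ha (m - s))
    (choose_pos_of_lt (x := m + b) (n := s) (by linarith))
  have e : (-1 : ℝ) ^ m * (-1) ^ s = (-1) ^ (m - s) := by
    obtain ⟨r, rfl⟩ := Nat.exists_eq_add_of_le hs
    rw [Nat.add_sub_cancel_left, pow_add, mul_right_comm, ← mul_pow]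
    norm_num
  rw [e]
  linarith

theorem jacobiPoly_eval_ne_zero_of_mem_Ioo {a b : ℝ} {m : ℕ} (ha0 : 0 < m + a) (ha1 : m + a < 1)
    (hb0 : -2 < b) (hb1 : b < -1)
    {x : ℝ} (hx : x ∈ Set.Icc (-1 : ℝ) 1) : (jacobiPoly a b m).eval x ≠ 0 := by
  rcases m with _ | m
  · simp [jacobiPoly]
  refine jacobiPoly_eval_ne_zero_of_sign ((-1) ^ m) (fun s hs => ?_) hx
  rcases hs.eq_or_lt with rfl | hlt
  -- In the top term only the last factor of the binomial product for `Ring.choose` is negative.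
  · have h := mul_pos (choose_pos_of_lt (x := ((m + 1 : ℕ) : ℝ) + b) (n := m)
      (by push_cast; linarith)) (by push_cast; linarith : 0 < m - (((m + 1 : ℕ) : ℝ) + b))
    have h3 := succ_mul_choose_succ (((m + 1 : ℕ) : ℝ) + b) m
    have h2 : 0 < ((m : ℝ) + 1) * (-Ring.choose (((m + 1 : ℕ) : ℝ) + b) (m + 1)) := by
      linarith
    have h4 := pos_of_mul_pos_right h2 (by positivity)
    have e : (-1 : ℝ) ^ m * (-1) ^ (m + 1) = -1 := by
      rw [pow_succ, ← mul_assoc, ← mul_pow]; norm_num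
    rw [e]
    simpa using h4
  · have hs' : (s : ℝ) ≤ m := by exact_mod_cast Nat.lt_succ_iff.1 hlt
    obtain ⟨r, rfl⟩ := Nat.exists_eq_add_of_le (Nat.lt_succ_iff.1 hlt)
    have h := mul_pos (neg_one_pow_mul_choose_succ_pos ha0 ha1 r)
      (choose_pos_of_lt (x := ((s + r + 1 : ℕ) : ℝ) + b) (n := s) (by
        push_cast at hs' ⊢; linarith))
    have e : (-1 : ℝ) ^ (s + r) * (-1) ^ s = (-1) ^ r := by
      rw [pow_add, mul_right_comm, ← mul_pow]; norm_num
    rw [e, show s + r + 1 - s = r + 1 by omega]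
    linarith

/-! ### Weight integrals and the classical norms. -/

theorem intervalIntegrable_jacobiWeight {a b : ℝ} (ha : -1 < a) (hb : -1 < b) :
    IntervalIntegrable (fun x : ℝ => (1 - x) ^ a * (1 + x) ^ b) volume (-1) 1 := by
  refine IntervalIntegrable.trans (b := 0) ?_ ?_
  · refine IntervalIntegrable.continuousOn_mul ?_ ?_
    · simpa using (intervalIntegral.intervalIntegrable_rpow' hb (a := 0) (b := 1)).comp_add_left 1
    · refine ContinuousOn.rpow_const (by fun_prop) fun x hx => Or.inl ?_
      rw [Set.uIcc_of_le (by norm_num)] at hx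
      linarith [hx.2]
  · refine IntervalIntegrable.mul_continuousOn ?_ ?_
    · simpa using (intervalIntegral.intervalIntegrable_rpow' ha (a := 1) (b := 0)).comp_sub_left 1
    · refine ContinuousOn.rpow_const (by fun_prop) fun x hx => Or.inl ?_
      rw [Set.uIcc_of_le (by norm_num)] at hx
      linarith [hx.1]

theorem integral_jacobiWeight {a b : ℝ} (ha : -1 < a) (hb : -1 < b) :
    ∫ x in (-1 : ℝ)..1, (1 - x) ^ a * (1 + x) ^ b =
      2 ^ (a + b + 1) * Real.Gamma (a + 1) * Real.Gamma (b + 1) / Real.Gamma (a + b + 2) := by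
  have hB : ∫ t in (0 : ℝ)..1, (1 - t) ^ a * t ^ b = ProbabilityTheory.beta (b + 1) (a + 1) := by
    rw [ProbabilityTheory.beta_eq_betaIntegralReal _ _ (by linarith) (by linarith),
      Complex.betaIntegral, ← Complex.ofReal_re (∫ t in (0 : ℝ)..1, (1 - t) ^ a * t ^ b),
      ← intervalIntegral.integral_ofReal]
    congr 1
    refine intervalIntegral.integral_congr fun t ht => ?_
    rw [Set.uIcc_of_le (by norm_num)] at ht
    have h1 : (0 : ℝ) ≤ 1 - t := by linarith [ht.2]
    push_cast
    rw [Complex.ofReal_cpow h1, Complex.ofReal_cpow ht.1]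
    push_cast
    rw [add_sub_cancel_right, add_sub_cancel_right, mul_comm]
  have hS := intervalIntegral.integral_comp_mul_add (a := 0) (b := 1)
    (fun x : ℝ => (1 - x) ^ a * (1 + x) ^ b) (two_ne_zero) (-1)
  have hL : ∫ t in (0 : ℝ)..1, (1 - (2 * t + -1)) ^ a * (1 + (2 * t + -1)) ^ b =
      2 ^ (a + b) * ∫ t in (0 : ℝ)..1, (1 - t) ^ a * t ^ b := by
    rw [← intervalIntegral.integral_const_mul]
    refine intervalIntegral.integral_congr fun t ht => ?_
    rw [Set.uIcc_of_le (by norm_num)] at ht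
    have h1 : (0 : ℝ) ≤ 1 - t := by linarith [ht.2]
    rw [show 1 - (2 * t + -1) = 2 * (1 - t) by ring, show 1 + (2 * t + -1) = 2 * t by ring,
      Real.mul_rpow (by norm_num) h1, Real.mul_rpow (by norm_num) ht.1,
      Real.rpow_add (by norm_num)]
    ring
  rw [hL, hB] at hS
  norm_num at hS
  rw [Real.rpow_add_one (by norm_num), ProbabilityTheory.beta] at *
  rw [show b + 1 + (a + 1) = a + b + 2 by ring] at hS
  linear_combination (-2) * hS

/-- Integration by parts against `(1 - x) ^ a * (1 + x) ^ b`, with vanishing boundary terms. -/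
theorem integral_jacobiWeight_mul_eq_zero {a b : ℝ} (ha : -1 < a) (hb : -1 < b) {g g' h : ℝ → ℝ}
    (hg : ContinuousOn g (Set.Icc (-1) 1)) (hg' : ∀ x ∈ Set.Ioo (-1 : ℝ) 1, HasDerivAt g (g' x) x)
    (hh : ContinuousOn h (Set.Icc (-1) 1))
    (heq : ∀ x ∈ Set.Ioo (-1 : ℝ) 1,
      ((b + 1) * (1 - x) - (a + 1) * (1 + x)) * g x + (1 - x ^ 2) * g' x = h x) :
    ∫ x in (-1 : ℝ)..1, (1 - x) ^ a * (1 + x) ^ b * h x = 0 := by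
  have hcont : ContinuousOn (fun x : ℝ => (1 - x) ^ (a + 1) * (1 + x) ^ (b + 1) * g x)
      (Set.Icc (-1) 1) := by
    refine ContinuousOn.mul (ContinuousOn.mul ?_ ?_) hg
    · exact ContinuousOn.rpow_const (by fun_prop) fun x _ => Or.inr (by linarith)
    · exact ContinuousOn.rpow_const (by fun_prop) fun x _ => Or.inr (by linarith)
  have hint : IntervalIntegrable (fun x : ℝ => (1 - x) ^ a * (1 + x) ^ b * h x) volume (-1) 1 :=
    (intervalIntegrable_jacobiWeight ha hb).mul_continuousOn
      (by rwa [Set.uIcc_of_le (by norm_num)])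
  rw [intervalIntegral.integral_eq_sub_of_hasDerivAt_of_le (by norm_num) hcont _ hint]
  · rw [sub_self, Real.zero_rpow (by linarith), show (1 : ℝ) + -1 = 0 by norm_num,
      Real.zero_rpow (by linarith)]
    ring
  · intro x hx
    have h1 : 0 < 1 - x := by linarith [hx.2]
    have h2 : 0 < 1 + x := by linarith [hx.1]
    have d1 := ((hasDerivAt_id x).const_sub 1).rpow_const (p := a + 1) (Or.inl h1.ne')
    have d2 := ((hasDerivAt_id x).const_add 1).rpow_const (p := b + 1) (Or.inl h2.ne')
    refine ((d1.mul d2).mul (hg' x hx)).congr_deriv ?_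
    simp only [id, Pi.mul_apply, add_sub_cancel_right]
    rw [← heq x hx, Real.rpow_add_one h1.ne', Real.rpow_add_one h2.ne']
    ring

theorem jacobiNorm_succ {a b : ℝ} {n : ℕ} (h : 0 < (n : ℝ) + a + b + 2) :
    jacobiNorm a b (n + 1) =
      ((n : ℝ) + a + b + 2) / (4 * (n + 1)) * jacobiNorm (a + 1) (b + 1) n := by
  have hG : (if n = 0 then Real.Gamma (a + 1 + (b + 1) + 2)
      else (a + 1 + (b + 1) + 2 * n + 1) * Real.Gamma (a + 1 + (b + 1) + n + 1)) =
      (a + b + 2 * n + 3) * Real.Gamma (a + b + n + 3) := by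
    split_ifs with hn
    · subst hn
      simp only [Nat.cast_zero, zero_add] at h ⊢
      rw [show a + 1 + (b + 1) + 2 = (a + b + 3) + 1 by ring, Real.Gamma_add_one (by linarith)]
      ring_nf
    · ring_nf
  have hG' : Real.Gamma (a + b + n + 3) = (a + b + n + 2) * Real.Gamma (a + b + n + 2) := by
    rw [← Real.Gamma_add_one (by linarith)]; ring_nf
  rw [jacobiNorm, jacobiNorm, hG, hG', if_neg n.succ_ne_zero, Nat.factorial_succ,
    show a + 1 + (b + 1) + 1 = a + b + 1 + (1 + 1) by ring, Real.rpow_add (by norm_num) (a + b + 1),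
    show (2 : ℝ) ^ (1 + 1 : ℝ) = 4 by norm_num]
  push_cast
  rw [show a + b + (n + 1) + 1 = a + b + n + 2 by ring,
    show a + 1 + 1 + (n : ℝ) = a + 1 + (n + 1) by ring,
    show b + 1 + 1 + (n : ℝ) = b + 1 + (n + 1) by ring,
    show a + b + 2 * (n + 1) + 1 = a + b + 2 * n + 3 by ring]
  have h1 : a + b + n + 2 ≠ 0 := by linarith
  have h2 : (a + b + 2 * n + 3) ≠ 0 := by linarith [n.cast_nonneg (α := ℝ)]
  have h3 : Real.Gamma (a + b + n + 2) ≠ 0 := (Real.Gamma_pos_of_pos (by linarith)).ne'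
  have h4 := n.factorial_ne_zero
  field_simp
  ring

/-- Integrating the Sturm-Liouville equation against `y` trades `y²` for `y'²`, and `y'` is a
multiple of the Jacobi polynomial with `n` lowered and both parameters raised by one. -/
theorem integral_jacobiPoly_sq {a b : ℝ} (ha : -1 < a) (hb : -1 < b) (n : ℕ) :
    ∫ x in (-1 : ℝ)..1, (1 - x) ^ a * (1 + x) ^ b * ((jacobiPoly a b n).eval x) ^ 2 =
      jacobiNorm a b n := by
  induction n generalizing a b with
  | zero => simp [jacobiPoly, jacobiNorm, integral_jacobiWeight ha hb]
  | succ n ih =>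
    have hn := n.cast_nonneg (α := ℝ)
    set y := jacobiPoly a b (n + 1) with hy
    have hder := jacobiPoly_derivative a b n
    have hode := jacobiPoly_ode a b (n + 1)
    rw [← hy] at hder hode
    set c := ((n : ℝ) + a + b + 2) / 2 with hc
    set l := ((n : ℝ) + 1) * (n + a + b + 2) with hl
    have h0 := integral_jacobiWeight_mul_eq_zero ha hb (g := fun x => y.eval x * (derivative y).eval x)
      (h := fun x => (1 - x) * (1 + x) * (c * (jacobiPoly (a + 1) (b + 1) n).eval x) ^ 2
        - l * (y.eval x) ^ 2) (by fun_prop)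
      (fun x _ => (y.hasDerivAt x).mul ((derivative y).hasDerivAt x)) (by fun_prop) (by
        intro x _
        have h1 := congrArg (eval x) hder
        have h2 := congrArg (eval x) hode
        simp only [eval_mul, eval_C, eval_add, eval_sub, eval_one, eval_pow, eval_X] at h1 h2
        push_cast at h2
        rw [← h1]
        simp only [hl]
        linear_combination (y.eval x) * h2)
    have i1 : ∀ p : ℝ → ℝ, Continuous p → IntervalIntegrable
        (fun x : ℝ => (1 - x) ^ a * (1 + x) ^ b * p x) volume (-1) 1 := fun p hp =>
      (intervalIntegrable_jacobiWeight ha hb).mul_continuousOn hp.continuousOn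
    simp only [mul_sub] at h0
    rw [intervalIntegral.integral_sub (i1 _ (by fun_prop)) (i1 _ (by fun_prop))] at h0
    have h3 : ∫ x in (-1 : ℝ)..1, (1 - x) ^ a * (1 + x) ^ b *
        ((1 - x) * (1 + x) * (c * (jacobiPoly (a + 1) (b + 1) n).eval x) ^ 2) =
        c ^ 2 * ∫ x in (-1 : ℝ)..1, (1 - x) ^ (a + 1) * (1 + x) ^ (b + 1) *
          ((jacobiPoly (a + 1) (b + 1) n).eval x) ^ 2 := by
      rw [← intervalIntegral.integral_const_mul]
      refine intervalIntegral.integral_congr_Ioo_of_le (by norm_num) fun x hx => ?_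
      have h1 : 0 < 1 - x := by linarith [hx.2]
      have h2 : 0 < 1 + x := by linarith [hx.1]
      rw [Real.rpow_add_one h1.ne', Real.rpow_add_one h2.ne']
      ring
    have h4 : ∫ x in (-1 : ℝ)..1, (1 - x) ^ a * (1 + x) ^ b * (l * (y.eval x) ^ 2) =
        l * ∫ x in (-1 : ℝ)..1, (1 - x) ^ a * (1 + x) ^ b * (y.eval x) ^ 2 := by
      rw [← intervalIntegral.integral_const_mul]
      exact intervalIntegral.integral_congr fun x _ => by ring
    rw [h3, h4, ih (by linarith) (by linarith)] at h0
    rw [jacobiNorm_succ (by linarith)]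
    have hl0 : l ≠ 0 := mul_ne_zero (by linarith) (by linarith)
    refine mul_left_cancel₀ hl0 ?_
    rw [← sub_eq_zero.1 h0, hl, hc]
    field_simp
    ring

/-! ### Norm transfer through the first-order operators. -/

theorem jacobiA_eq (a b : ℝ) (m : ℕ) (y : ℝ[X]) :
    jacobiA a b m y = (1 - X) * (xiPoly a b m * derivative y - derivative (xiPoly a b m) * y) -
      C a * xiPoly a b m * y := by
  rw [jacobiA, xiPoly_contiguous]
  ring

/-- The adjoint first-order operator maps `A (P_k)` back to a multiple of `ξ P_k`. -/
theorem jacobiA_adjoint (a b : ℝ) (m k : ℕ) :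
    (1 + X) * derivative (jacobiA a b m (jacobiPoly a b k)) +
        C (b + 1) * jacobiA a b m (jacobiPoly a b k) =
      -(C ((a + k - m) * (b + 1 + m + k)) * xiPoly a b m * jacobiPoly a b k) := by
  have h1 := jacobiPoly_ode a b k
  have h2 : (1 - X ^ 2) * derivative (derivative (xiPoly a b m)) =
      (C (-a - b) + C (-a + b + 2) * X) * derivative (xiPoly a b m) -
      C ((m : ℝ) * (m + -a + b + 1)) * xiPoly a b m := jacobiPoly_ode (-a) b m
  rw [jacobiA_eq]
  simp only [derivative_sub, derivative_mul, derivative_C, derivative_one, derivative_X]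
  simp only [C_add, C_sub, C_mul, C_neg, C_1, show (C (2 : ℝ) : ℝ[X]) = 2 from rfl] at h1 h2 ⊢
  linear_combination xiPoly a b m * h1 - jacobiPoly a b k * h2

/-- The transfer of the norm of `A y` to an integral against the weight
`(1 - x) ^ a * (1 + x) ^ (b + 1)`, valid as soon as `b > -2` and `b ≠ -1`. -/
theorem integral_jacobiA_sq {a b : ℝ} (ha : 0 < a) (hb : -2 < b) (hb1 : b ≠ -1) {ξ y A u r : ℝ[X]}
    {c L : ℝ} (hξ : ∀ x ∈ Set.Icc (-1 : ℝ) 1, ξ.eval x ≠ 0)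
    (hA : A = (1 - X) * (ξ * derivative y - derivative ξ * y) - C a * ξ * y)
    (hadj : (1 + X) * derivative A + C (b + 1) * A = -(C L * ξ * y))
    (hu : C c * y ^ 2 = (1 - X ^ 2) * derivative u + C (b + 1) * (1 - X) * u -
      C (a + 1) * (1 + X) * u + (1 + X) * r) :
    c * ∫ x in (-1 : ℝ)..1, (1 - x) ^ (a - 1) * (1 + x) ^ (b + 1) * (A.eval x / ξ.eval x) ^ 2 =
      L * ∫ x in (-1 : ℝ)..1, (1 - x) ^ a * (1 + x) ^ (b + 1) * r.eval x := by
  -- The antiderivative is `(1-x)^a (1+x)^(b+1) (c y A / ξ + L (1-x) u)`. Its exponent `b + 1` may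
  -- be negative; the bracket vanishes at `-1` because `b ≠ -1`, and the extra factor `1 + x` kills
  -- the boundary term.
  obtain ⟨Q, hQ⟩ : X - C (-1) ∣ C c * y * A + C L * (1 - X) * u * ξ := by
    rw [dvd_iff_isRoot, IsRoot]
    have h1 := congrArg (eval (-1)) hadj
    have h2 := congrArg (eval (-1)) hu
    simp only [eval_mul, eval_C, eval_add, eval_sub, eval_one, eval_pow, eval_X, eval_neg]
      at h1 h2 ⊢
    refine mul_left_cancel₀ (sub_ne_zero.2 hb1) ?_
    linear_combination c * y.eval (-1) * h1 - L * ξ.eval (-1) * h2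
  have hi1 : -1 < a - 1 := by linarith
  have hi2 : -1 < b + 1 := by linarith
  have hξc : ContinuousOn (fun x => ξ.eval x) (Set.Icc (-1) 1) := ξ.continuous.continuousOn
  have hAξ : ContinuousOn (fun x => c * (A.eval x / ξ.eval x) ^ 2) (Set.Icc (-1) 1) :=
    continuousOn_const.mul ((A.continuous.continuousOn.div hξc hξ).pow 2)
  have h0 := integral_jacobiWeight_mul_eq_zero hi1 hi2
    (g := fun x => Q.eval x / ξ.eval x)
    (h := fun x => c * (A.eval x / ξ.eval x) ^ 2 - L * ((1 - x) * r.eval x))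
    (Q.continuous.continuousOn.div hξc hξ)
    (fun x hx => (Q.hasDerivAt x).div (ξ.hasDerivAt x) (hξ x (Set.Ioo_subset_Icc_self hx)))
    (hAξ.sub (by fun_prop)) (by
      intro x hx
      have hx' : 1 + x ≠ 0 := by linarith [hx.1]
      have hξ0 := hξ x (Set.Ioo_subset_Icc_self hx)
      have hG := congrArg (eval x) hQ
      have hG' := congrArg (fun p => eval x (derivative p)) hQ
      have h1 := congrArg (eval x) hadj
      have h2 := congrArg (eval x) hu
      have h3 := congrArg (eval x) hA
      simp only [derivative_mul, derivative_add, derivative_sub, derivative_C, derivative_one,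
        derivative_X] at hG'
      simp only [eval_mul, eval_C, eval_add, eval_sub, eval_one, eval_pow, eval_X, eval_neg,
        eval_zero] at h1 h2 h3 hG hG'
      have key : ((b + 2) * (1 - x) - a * (1 + x)) * Q.eval x * ξ.eval x + (1 - x ^ 2) *
          ((derivative Q).eval x * ξ.eval x - Q.eval x * (derivative ξ).eval x) =
          c * A.eval x ^ 2 - L * (1 - x) * r.eval x * ξ.eval x ^ 2 := by
        refine mul_left_cancel₀ hx' ?_
        linear_combination (a * (1 + x) * ξ.eval x - (b + 1) * (1 - x) * ξ.eval x +
            (1 - x ^ 2) * (derivative ξ).eval x) * hG - (1 - x ^ 2) * ξ.eval x * hG' +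
          c * (1 - x) * y.eval x * ξ.eval x * h1 - L * (1 - x) * ξ.eval x ^ 2 * h2 -
          c * (1 + x) * A.eval x * h3
      field_simp
      linear_combination key)
  have i1 : ∀ p : ℝ → ℝ, ContinuousOn p (Set.Icc (-1) 1) → IntervalIntegrable
      (fun x : ℝ => (1 - x) ^ (a - 1) * (1 + x) ^ (b + 1) * p x) volume (-1) 1 := fun p hp =>
    (intervalIntegrable_jacobiWeight hi1 hi2).mul_continuousOn
      (by rwa [Set.uIcc_of_le (by norm_num)])
  simp only [mul_sub] at h0
  rw [intervalIntegral.integral_sub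
    (i1 _ hAξ) (i1 _ (by fun_prop)), sub_eq_zero] at h0
  rw [← intervalIntegral.integral_const_mul, ← intervalIntegral.integral_const_mul]
  refine (intervalIntegral.integral_congr fun x _ => by ring).trans (h0.trans ?_)
  refine intervalIntegral.integral_congr_Ioo_of_le (by norm_num) fun x hx => ?_
  have h1 : 0 < 1 - x := by linarith [hx.2]
  have h2 : (1 - x) ^ a = (1 - x) ^ (a - 1) * (1 - x) := by
    rw [← Real.rpow_add_one h1.ne', sub_add_cancel]
  rw [h2]
  ring

theorem integral_jacobiA_jacobiPoly_sq {a b : ℝ} {m : ℕ} (k : ℕ) (ha : 0 < a) (hb : -2 < b)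
    (hb1 : b ≠ -1)
    (hξ : ∀ x ∈ Set.Icc (-1 : ℝ) 1, (xiPoly a b m).eval x ≠ 0) :
    ∫ x in (-1 : ℝ)..1, (1 - x) ^ (a - 1) * (1 + x) ^ (b + 1) *
        ((jacobiA a b m (jacobiPoly a b k)).eval x / (xiPoly a b m).eval x) ^ 2 =
      (a + k - m) * (b + 1 + m + k) * jacobiNorm a b k := by
  have key := fun u r c => integral_jacobiA_sq (u := u) (r := r) (c := c) ha hb hb1 hξ
    (jacobiA_eq a b m _) (jacobiA_adjoint a b m k)
  rcases k with _ | k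
  -- With `y = u = 1`, the value at `x = -1` forces `c = 2 (b + 1)`.
  · have h := key 1 (C (a + b + 2)) (2 * (b + 1)) (by
      simp [jacobiPoly, C_add, C_mul, show (C (2 : ℝ) : ℝ[X]) = 2 from rfl]
      ring)
    simp only [eval_C, intervalIntegral.integral_mul_const] at h
    rw [integral_jacobiWeight (by linarith) (by linarith)] at h
    have hb2 : b + 1 ≠ 0 := by contrapose! hb1; linarith
    have h1 : 2 * (b + 1) ≠ 0 := mul_ne_zero two_ne_zero hb2
    have h2 : a + b + 2 ≠ 0 := by linarith
    have h3 : Real.Gamma (a + b + 2) ≠ 0 := (Real.Gamma_pos_of_pos (by linarith)).ne'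
    refine mul_left_cancel₀ h1 (h.trans ?_)
    rw [show a + (b + 1) + 2 = a + b + 2 + 1 by ring, Real.Gamma_add_one h2,
      Real.Gamma_add_one hb2, show a + (b + 1) + 1 = a + b + 1 + 1 by ring,
      Real.rpow_add_one (by norm_num)]
    simp [jacobiNorm]
    field_simp
  · have hder := jacobiPoly_derivative a b k
    have hode := jacobiPoly_ode a b (k + 1)
    set y := jacobiPoly a b (k + 1) with hy
    have hk := k.cast_nonneg (α := ℝ)
    -- The equation for `y` times `y`, with `c` the eigenvalue; the remainder is again the weighted
    -- `y'²`.
    have h := key (-(y * derivative y)) ((1 - X) * derivative y ^ 2)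
      (((k + 1 : ℕ) : ℝ) * ((k + 1 : ℕ) + a + b + 1)) (by
        simp only [derivative_neg, derivative_mul]
        simp only [C_add, C_sub, C_mul, C_1, show (C (2 : ℝ) : ℝ[X]) = 2 from rfl] at hode ⊢
        linear_combination y * hode)
    have h3 : ∫ x in (-1 : ℝ)..1, (1 - x) ^ a * (1 + x) ^ (b + 1) *
        ((1 - X) * derivative y ^ 2 : ℝ[X]).eval x =
        (((k : ℝ) + a + b + 2) / 2) ^ 2 * jacobiNorm (a + 1) (b + 1) k := by
      rw [← integral_jacobiPoly_sq (by linarith) (by linarith),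
        ← intervalIntegral.integral_const_mul]
      refine intervalIntegral.integral_congr_Ioo_of_le (by norm_num) fun x hx => ?_
      have h1 : 0 < 1 - x := by linarith [hx.2]
      simp only [hder, eval_mul, eval_pow, eval_sub, eval_one, eval_X, eval_C]
      rw [Real.rpow_add_one h1.ne']
      ring
    rw [h3] at h
    rw [jacobiNorm_succ (by linarith)]
    push_cast at h ⊢
    have hl : ((k : ℝ) + 1) * (k + 1 + a + b + 1) ≠ 0 := mul_ne_zero (by linarith) (by linarith)
    refine mul_left_cancel₀ hl (h.trans ?_)
    field_simp
    ring

theorem mainTheorem6 (m : ℕ) (hm : 1 ≤ m) (α β : ℝ) (hα : -1 < α) (hβ : -1 < β)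
    (hβ0 : β ≠ 0)
    (hns : ∀ i : ℕ, i < m → α ≠ (i : ℝ) ∧ α - β - (m : ℝ) + 1 ≠ (i : ℝ))
    (hαm : (m : ℝ) - 2 < α)
    (hsgn : SignType.sign (α - (m : ℝ) + 1) = SignType.sign β) (k : ℕ) :
    IntervalIntegrable
        (fun x : ℝ => ((xmJacobi α β m (m + k)).eval x) ^ 2 * xmWeight α β m x)
        volume (-1) 1 ∧
      ∫ x in (-1 : ℝ)..1, ((xmJacobi α β m (m + k)).eval x) ^ 2 * xmWeight α β m x =
        (1 + α + (k : ℝ) - (m : ℝ)) * (β + (m : ℝ) + (k : ℝ)) / (α + 1 + (k : ℝ)) ^ 2 *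
          jacobiNorm (α + 1) (β - 1) k := by
  have hξ : ∀ x ∈ Set.Icc (-1 : ℝ) 1, (xiPoly (α + 1) (β - 1) m).eval x ≠ 0 := by
    intro x hx
    rcases hβ0.lt_or_gt with h | h
    -- Here `m - (α + 1)` lies in `(0, 1)` and `β - 1` in `(-2, -1)`.
    · rw [sign_neg h, sign_eq_neg_one_iff] at hsgn
      exact jacobiPoly_eval_ne_zero_of_mem_Ioo (by linarith) (by linarith) (by linarith)
        (by linarith) hx
    · rw [sign_pos h, sign_eq_one_iff] at hsgn
      exact jacobiPoly_eval_ne_zero_of_neg (by linarith) (by linarith) hx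
  set A := jacobiA (α + 1) (β - 1) m (jacobiPoly (α + 1) (β - 1) k) with hAdef
  have hfun : (fun x : ℝ => ((xmJacobi α β m (m + k)).eval x) ^ 2 * xmWeight α β m x) =
      fun x => ((1 - x) ^ α * (1 + x) ^ β * (A.eval x / (xiPoly (α + 1) (β - 1) m).eval x) ^ 2) /
        (α + 1 + (k : ℝ)) ^ 2 := by
    ext x
    rw [xmJacobi, xmWeight, Nat.add_sub_cancel_left, ← hAdef, eval_mul, eval_C, mul_pow, div_pow,
      ← pow_mul, pow_mul', neg_one_sq, one_pow, div_pow]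
    ring
  rw [hfun]
  constructor
  · refine ((intervalIntegrable_jacobiWeight hα hβ).mul_continuousOn ?_).div_const _
    rw [Set.uIcc_of_le (by norm_num)]
    exact (A.continuous.continuousOn.div (Polynomial.continuous _).continuousOn hξ).pow 2
  · rw [intervalIntegral.integral_div]
    have h := integral_jacobiA_jacobiPoly_sq (a := α + 1) (b := β - 1) k (by linarith)
      (by linarith) (by contrapose! hβ0; linarith) hξ
    rw [← hAdef] at h
    simp only [add_sub_cancel_right, sub_add_cancel] at h
    rw [h]
    ring
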